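/- Let $q\in H^{-1}_{per}(\mathbb{R},\mathbb{R})$ be a real-valued $1$-periodic distribution, i.e. $q=\sum_{k\in 2\mathbb{Z}}\widehat{q}(k)e^{ik\pi x}$ (convergence in the sense of distributions) with $\sum_{k\in 2\mathbb{Z}}(1+|k|)^{-2}|\widehat{q}(k)|^{2}<\infty$ and $\widehat{q}(-k)=\overline{\widehat{q}(k)}$ for all $k\in 2\mathbb{Z}$. Let $$Q(x)=\sum_{k\in 2\mathbb{Z}\setminus\{0\}}\frac{\widehat{q}(k)}{ik\pi}\,e^{ik\pi x}\in L_{2,per}(\mathbb{R},\mathbb{R}),$$ so that $q=\widehat{q}(0)+Q'$ in the sense of distributions, and put $$l_{Q}[u]:=-(u'-Qu)'-Q(u'-Qu)-Q^{2}u .$$ Let $S_{max}(q)$ be the operator on the complex Hilbert space $L_{2}(\mathbb{R})$ with domain $$\mathrm{Dom}(S_{max}(q))=\{u\in L_{2}(\mathbb{R})\mid u,\;u'-Qu\in W^{1}_{1,loc}(\mathbb{R}),\; l_{Q}[u]\in L_{2}(\mathbb{R})\}$$ acting as $S_{max}(q)u=l_{Q}[u]+\widehat{q}(0)u$ (that is,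 $S_{max}(q)u=l_{Q}[u]$ under the normalization $\widehat{q}(0)=0$). Then the point spectrum of $S_{max}(q)$ is empty: there are no $\lambda\in\mathbb{C}$ and $u\in\mathrm{Dom}(S_{max}(q))$, $u\neq 0$, with $S_{max}(q)u=\lambda u$. -/

import Mathlib

open MeasureTheory
open scoped Distributions ComplexConjugate

noncomputable section

namespace HillSchrodinger

/-- The 1-periodic exponential `x ↦ e^{ikπx}` with `k = 2n`. -/
def expMode (n : ℤ) (x : ℝ) : ℂ :=
  Complex.exp (2 * Real.pi * Complex.I * n * x)

/-- An element of `H^s_per(ℝ, ℝ)`: a complex distribution `q` on the line which is the sum, in the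
sense of distributions, of a Fourier series `∑ q̂(k) e^{ikπx}`, `k = 2n`, with
`∑ (1 + |k|)^{2s} |q̂(k)|² < ∞`, and which is real-valued, i.e. `q̂(-k)` is the conjugate of `q̂(k)`.
(The Fourier coefficients are uniquely determined by the distribution; `coeff n` is `q̂(2n)`.) -/
structure RealPerSobolev (s : ℝ) where
  /-- the underlying distribution on the real line -/
  toDistribution : 𝓓'((⊤ : TopologicalSpace.Opens ℝ), ℂ)
  /-- the Fourier coefficients -/
  coeff : ℤ → ℂ
  hasSum_fourier : ∀ φ : 𝓓((⊤ : TopologicalSpace.Opens ℝ), ℝ),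
    HasSum (fun n : ℤ => coeff n * ∫ x : ℝ, expMode n x * (φ x : ℂ)) (toDistribution φ)
  summable_coeff : Summable fun n : ℤ => (1 + |2 * (n : ℝ)|) ^ (2 * s) * ‖coeff n‖ ^ 2
  coeff_neg : ∀ n : ℤ, coeff (-n) = conj (coeff n)

/-- Fourier coefficients of the zero-mean periodic antiderivative of `q - q̂(0)`:
`q̂(k) / (ikπ)` for `k = 2n ≠ 0`, and `0` for `k = 0`. -/
def antiderivCoeff (q : RealPerSobolev (-1)) (n : ℤ) : ℂ :=
  if n = 0 then 0 else q.coeff n / (2 * Real.pi * Complex.I * n)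

theorem memlp_antiderivCoeff (q : RealPerSobolev (-1)) : Memℓp (antiderivCoeff q) 2 := by
  refine memℓp_gen ?_
  have h := q.summable_coeff
  refine Summable.of_nonneg_of_le (fun n => by positivity) (fun n => ?_) h
  simp only [ENNReal.toReal_ofNat, Real.rpow_ofNat]
  unfold antiderivCoeff
  split_ifs with hn
  · rw [norm_zero, zero_pow two_ne_zero]
    positivity
  · have hn1 : (1 : ℝ) ≤ |(n : ℝ)| := by
      have : (1 : ℤ) ≤ |n| := Int.one_le_abs hn
      exact_mod_cast this
    have hpi := Real.pi_gt_three
    have hnorm : ‖(2 * Real.pi * Complex.I * n : ℂ)‖ = 2 * Real.pi * |(n : ℝ)| := by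
      simp [abs_of_pos Real.pi_pos]
    have hpos : (0 : ℝ) < 1 + |2 * (n : ℝ)| := by positivity
    have hab : |2 * (n : ℝ)| = 2 * |(n : ℝ)| := by simp [abs_mul]
    have hle : 1 + |2 * (n : ℝ)| ≤ 2 * Real.pi * |(n : ℝ)| := by
      rw [hab]; nlinarith
    have hw : (1 + |2 * (n : ℝ)|) ^ (2 * (-1 : ℝ)) = ((1 + |2 * (n : ℝ)|) ^ 2)⁻¹ := by
      rw [show (2 * (-1 : ℝ)) = -((2 : ℕ) : ℝ) by norm_num, Real.rpow_neg hpos.le,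
        Real.rpow_natCast]
    rw [norm_div, hnorm, hw, div_pow, div_eq_inv_mul]
    gcongr

/-- `Q = ∑_{k ≠ 0} q̂(k) / (ikπ) e^{ikπx}`, as an element of `L²` of the circle `ℝ / ℤ`. -/
def antiderivL2 (q : RealPerSobolev (-1)) : Lp ℂ 2 (AddCircle.haarAddCircle (T := (1 : ℝ))) :=
  (fourierBasis (T := (1 : ℝ))).repr.symm ⟨antiderivCoeff q, memlp_antiderivCoeff q⟩

/-- The 1-periodic function `Q` on the line, with `q = q̂(0) + Q'` in the sense of distributions. -/
def antideriv (q : RealPerSobolev (-1)) (x : ℝ) : ℂ :=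
  antiderivL2 q (x : AddCircle (1 : ℝ))

/-- Local absolute continuity on the line. A class of functions belongs to `W^1_{1,loc}(ℝ)` iff it
has a locally absolutely continuous representative `f`, and then its derivative is the class of
`deriv f`. -/
def IsLocAC (f : ℝ → ℂ) : Prop :=
  ∀ a b : ℝ, AbsolutelyContinuousOnInterval f a b

/-- The quasi-derivative `u^{[1]} = u' - Q u`. -/
def quasiDeriv (Q u : ℝ → ℂ) (x : ℝ) : ℂ :=
  deriv u x - Q x * u x

/-- The quasi-differential expression `l_Q[u] = -v' - Q v - Q² u`, where `v` is the locally
absolutely continuous representative of `u' - Q u`. -/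
def quasiExpr (Q u v : ℝ → ℂ) (x : ℝ) : ℂ :=
  -deriv v x - Q x * v x - Q x ^ 2 * u x

/-- `L₂(ℝ)` -/
abbrev L2 : Type := Lp ℂ 2 (volume : Measure ℝ)

/-- `IsQuasiImage Q C f g`: the classes `f, g ∈ L₂(ℝ)` satisfy `f, f' - Q f ∈ W^1_{1,loc}(ℝ)` and
`g = l_Q[f] + C f`. -/
def IsQuasiImage (Q : ℝ → ℂ) (C : ℂ) (f g : L2) : Prop :=
  ∃ u v : ℝ → ℂ, IsLocAC u ∧ IsLocAC v ∧ f =ᵐ[volume] u ∧ quasiDeriv Q u =ᵐ[volume] v ∧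
    g =ᵐ[volume] fun x => quasiExpr Q u v x + C * u x

theorem IsLocAC.continuous {f : ℝ → ℂ} (hf : IsLocAC f) : Continuous f := by
  rw [continuous_iff_continuousAt]
  intro x
  have h := (hf (x - 1) (x + 1)).continuousOn
  rw [Set.uIcc_of_le (by linarith)] at h
  exact h.continuousAt (Icc_mem_nhds (by linarith) (by linarith))

theorem IsLocAC.ae_differentiableAt {f : ℝ → ℂ} (hf : IsLocAC f) :
    ∀ᵐ x : ℝ, DifferentiableAt ℝ f x := by
  have h : ∀ n : ℕ, ∀ᵐ x : ℝ, x ∈ Set.uIcc (-(n : ℝ)) n → DifferentiableAt ℝ f x := fun n =>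
    (hf _ _).boundedVariationOn.ae_differentiableAt_of_mem_uIcc
  filter_upwards [ae_all_iff.2 h] with x hx
  obtain ⟨n, hn⟩ := exists_nat_ge |x|
  refine hx n ?_
  rw [Set.uIcc_of_le (by linarith [abs_nonneg x])]
  exact abs_le.1 hn

/-- The graph of the maximal operator. -/
def maxGraph (Q : ℝ → ℂ) (C : ℂ) : Submodule ℂ (L2 × L2) where
  carrier := {p | IsQuasiImage Q C p.1 p.2}
  zero_mem' := by
    refine ⟨0, 0, ?_, ?_, Lp.coeFn_zero _ _ _, ?_, ?_⟩
    · intro a b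
      exact (contDiff_const (c := (0 : ℂ))).contDiffOn.absolutelyContinuousOnInterval
    · intro a b
      exact (contDiff_const (c := (0 : ℂ))).contDiffOn.absolutelyContinuousOnInterval
    · refine Filter.Eventually.of_forall fun x => ?_
      simp [quasiDeriv]
    · filter_upwards [Lp.coeFn_zero ℂ 2 (volume : Measure ℝ)] with x _
      simp [quasiExpr]
  add_mem' := by
    rintro p r ⟨u, v, hu, hv, hpu, huv, hp⟩ ⟨y, z, hy, hz, hry, hyz, hr⟩
    refine ⟨u + y, v + z, fun a b => (hu a b).add (hy a b), fun a b => (hv a b).add (hz a b),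
      ?_, ?_, ?_⟩
    · exact (Lp.coeFn_add _ _).trans (hpu.add hry)
    · filter_upwards [huv, hyz, hu.ae_differentiableAt, hy.ae_differentiableAt]
        with x h1 h2 h3 h4
      simp only [quasiDeriv, Pi.add_apply] at *
      rw [deriv_add h3 h4, ← h1, ← h2]
      ring
    · filter_upwards [Lp.coeFn_add p.2 r.2, hp, hr, hv.ae_differentiableAt, hz.ae_differentiableAt]
        with x h0 h1 h2 h3 h4
      simp only [quasiExpr, Prod.snd_add, Pi.add_apply] at *
      rw [h0, deriv_add h3 h4, h1, h2]
      ring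
  smul_mem' := by
    rintro c p ⟨u, v, hu, hv, hpu, huv, hp⟩
    refine ⟨fun x => c • u x, fun x => c • v x, fun a b => (hu a b).const_smul c,
      fun a b => (hv a b).const_smul c, ?_, ?_, ?_⟩
    · filter_upwards [Lp.coeFn_smul c p.1, hpu] with x h0 h1
      simp only [Prod.smul_fst, Pi.smul_apply] at *
      rw [h0, h1]
    · filter_upwards [huv, hu.ae_differentiableAt] with x h1 h3
      simp only [quasiDeriv, smul_eq_mul] at *
      rw [deriv_const_mul c h3, ← h1]
      ring
    · filter_upwards [Lp.coeFn_smul c p.2, hp, hv.ae_differentiableAt] with x h0 h1 h3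
      simp only [quasiExpr, Prod.smul_snd, Pi.smul_apply, smul_eq_mul] at *
      rw [h0, h1, deriv_const_mul c h3]
      ring

theorem maxGraph_singleValued (Q : ℝ → ℂ) (C : ℂ) (p : L2 × L2) (hp : p ∈ maxGraph Q C)
    (h0 : p.1 = 0) : p.2 = 0 := by
  obtain ⟨u, v, hu, hv, hpu, huv, hg⟩ := hp
  have hu0 : u = fun _ => 0 := by
    refine (Continuous.ae_eq_iff_eq (volume : Measure ℝ) hu.continuous continuous_const).1 ?_
    rw [h0] at hpu
    exact hpu.symm.trans (Lp.coeFn_zero _ _ _)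
  have hv0 : v = fun _ => 0 := by
    refine (Continuous.ae_eq_iff_eq (volume : Measure ℝ) hv.continuous continuous_const).1 ?_
    refine huv.symm.trans (Filter.Eventually.of_forall fun x => ?_)
    simp [quasiDeriv, hu0]
  refine Lp.ext (hg.trans (Filter.EventuallyEq.trans ?_ (Lp.coeFn_zero _ _ _).symm))
  refine Filter.Eventually.of_forall fun x => ?_
  simp [quasiExpr, hu0, hv0]

/-- The maximal operator `S_max(q)` on `L₂(ℝ)`: its domain is the set of `u ∈ L₂(ℝ)` with
`u, u' - Qu ∈ W^1_{1,loc}(ℝ)` and `l_Q[u] ∈ L₂(ℝ)`, and it maps `u` to `l_Q[u] + q̂(0) u`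
(which is `l_Q[u]` when `q̂(0) = 0`). -/
def Smax (q : RealPerSobolev (-1)) : L2 →ₗ.[ℂ] L2 :=
  (maxGraph (antideriv q) (q.coeff 0)).toLinearPMap

theorem mem_Smax_graph (q : RealPerSobolev (-1)) (f g : L2) :
    (f, g) ∈ (Smax q).graph ↔ IsQuasiImage (antideriv q) (q.coeff 0) f g := by
  unfold Smax
  rw [Submodule.toLinearPMap_graph_eq _ (maxGraph_singleValued _ _)]
  exact Iff.rfl

/-- The point spectrum (set of eigenvalues) of an unbounded operator. -/
def pointSpectrum {H : Type*} [AddCommGroup H] [Module ℂ H] (A : H →ₗ.[ℂ] H) : Set ℂ :=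
  {z | ∃ f : A.domain, (f : H) ≠ 0 ∧ A f = z • (f : H)}

end HillSchrodinger

end

namespace HillSchrodinger

open Filter Set Topology

/-! An eigenfunction `u` and `v = u' - Q u` solve a linear first-order system with 1-periodic
coefficients, locally integrable because `Q` is locally square integrable. Solutions are determined
by their value at one point (`eq_zero_of_norm_deriv_le`), so those with `u ∈ L₂(ℝ)` form a
finite-dimensional space. Translation by one period preserves it; were it nonzero, the translation
would have an eigenvector there, with `u (x + 1) = ρ * u x`. No nonzero such `u` is square
integrable (`eq_zero_of_memLp_of_floquet`). Neither existence of solutions nor a monodromy matrix is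
needed. -/

/-! ### Local absolute continuity and uniqueness for the Cauchy problem. -/

lemma IsLocAC.comp_lipschitz {f : ℝ → ℂ} (hf : IsLocAC f) {g : ℂ → ℝ}
    (hg : ∀ z w, dist (g z) (g w) ≤ dist z w) (a b : ℝ) :
    AbsolutelyContinuousOnInterval (fun x => g (f x)) a b :=
  squeeze_zero (fun _ => Finset.sum_nonneg fun _ _ => dist_nonneg)
    (fun _ => Finset.sum_le_sum fun _ _ => hg _ _) (hf a b)

lemma IsLocAC.comp_add_const {f : ℝ → ℂ} (hf : IsLocAC f) (t : ℝ) :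
    IsLocAC fun x => f (x + t) := by
  intro a b
  rw [absolutelyContinuousOnInterval_iff]
  intro ε hε
  obtain ⟨δ, hδ, h⟩ := (absolutelyContinuousOnInterval_iff _ _ _).1 (hf (a + t) (b + t)) ε hε
  refine ⟨δ, hδ, fun E hE hlen => ?_⟩
  refine h (E.1, fun i => ((E.2 i).1 + t, (E.2 i).2 + t)) ⟨fun i hi => ?_, ?_⟩ (by simpa using hlen)
  · have := hE.1 i hi
    rw [← image_add_const_uIcc]
    exact ⟨⟨_, this.1, rfl⟩, ⟨_, this.2, rfl⟩⟩
  · intro i hi j hj hij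
    have := hE.2 hi hj hij
    simp only [Function.onFun] at this ⊢
    have key : ∀ k, uIoc ((E.2 k).1 + t) ((E.2 k).2 + t) =
        (fun x => x - t) ⁻¹' uIoc (E.2 k).1 (E.2 k).2 := by
      intro k
      simp [uIoc, min_add_add_right, max_add_add_right]
    rw [key, key]
    exact this.preimage _

/-- The increment of a locally absolutely continuous function is controlled by the integral of any
majorant of the norm of its derivative. -/
lemma IsLocAC.norm_sub_le {f : ℝ → ℂ} (hf : IsLocAC f) {a b : ℝ} {g : ℝ → ℝ}
    (hg : IntervalIntegrable g volume a b)
    (hfg : ∀ᵐ x : ℝ, x ∈ uIoc a b → ‖deriv f x‖ ≤ g x) :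
    ‖f b - f a‖ ≤ 2 * |∫ x in a..b, g x| := by
  have hre : |(f b).re - (f a).re| ≤ |∫ x in a..b, g x| := by
    rw [← Real.norm_eq_abs, ← (hf.comp_lipschitz (g := Complex.re) (fun z w => ?_) a b).integral_deriv_eq_sub]
    · refine intervalIntegral.norm_integral_le_abs_of_norm_le ?_ hg
      rw [ae_restrict_iff' measurableSet_uIoc]
      filter_upwards [hfg, hf.ae_differentiableAt] with x hx hd hxm
      have : HasDerivAt (fun x => (f x).re) (deriv f x).re x :=
        Complex.reCLM.hasFDerivAt.comp_hasDerivAt x hd.hasDerivAt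
      rw [this.deriv]
      exact (Complex.abs_re_le_norm _).trans (hx hxm)
    · rw [Real.dist_eq, dist_eq_norm, ← Complex.sub_re]
      exact Complex.abs_re_le_norm _
  have him : |(f b).im - (f a).im| ≤ |∫ x in a..b, g x| := by
    rw [← Real.norm_eq_abs, ← (hf.comp_lipschitz (g := Complex.im) (fun z w => ?_) a b).integral_deriv_eq_sub]
    · refine intervalIntegral.norm_integral_le_abs_of_norm_le ?_ hg
      rw [ae_restrict_iff' measurableSet_uIoc]
      filter_upwards [hfg, hf.ae_differentiableAt] with x hx hd hxm
      have : HasDerivAt (fun x => (f x).im) (deriv f x).im x :=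
        Complex.imCLM.hasFDerivAt.comp_hasDerivAt x hd.hasDerivAt
      rw [this.deriv]
      exact (Complex.abs_im_le_norm _).trans (hx hxm)
    · rw [Real.dist_eq, dist_eq_norm, ← Complex.sub_im]
      exact Complex.abs_im_le_norm _
  -- The factor 2 is the price of treating real and imaginary parts separately.
  have := Complex.norm_le_abs_re_add_abs_im (f b - f a)
  rw [Complex.sub_re, Complex.sub_im] at this
  linarith

/-- A pair of locally absolutely continuous functions whose derivatives are bounded by a locally
integrable multiple of the pair vanishes identically as soon as it vanishes at one point. -/
lemma eq_zero_of_norm_deriv_le {u v : ℝ → ℂ} (hu : IsLocAC u) (hv : IsLocAC v) {a : ℝ → ℝ}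
    (ha : ∀ s t, IntervalIntegrable a volume s t) (ha0 : ∀ x, 0 ≤ a x)
    (hdu : ∀ᵐ x : ℝ, ‖deriv u x‖ ≤ a x * (‖u x‖ + ‖v x‖))
    (hdv : ∀ᵐ x : ℝ, ‖deriv v x‖ ≤ a x * (‖u x‖ + ‖v x‖)) {x₀ : ℝ}
    (hu0 : u x₀ = 0) (hv0 : v x₀ = 0) (x : ℝ) : u x = 0 ∧ v x = 0 := by
  have hcont : Continuous fun x => ‖u x‖ + ‖v x‖ := hu.continuous.norm.add hv.continuous.norm
  set S : Set ℝ := {x | ‖u x‖ + ‖v x‖ = 0} with hS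
  have hclosed : IsClosed S := isClosed_eq hcont continuous_const
  -- Near a zero `y`, take a ball on which the integral of `a` from `y` stays below 1/8, and let `m`
  -- be the maximum of `‖u‖ + ‖v‖` on the closed ball of half the radius, attained at `t`. Each of
  -- `‖u t‖`, `‖v t‖` is at most `2 * (m / 8)`, so `m ≤ m / 2` and `m = 0`.
  have hopen : IsOpen S := by
    rw [Metric.isOpen_iff]
    intro y hy
    have hyu : u y = 0 := by
      rw [← norm_eq_zero]; exact le_antisymm (by linarith [norm_nonneg (v y), hy.le]) (norm_nonneg _)
    have hyv : v y = 0 := by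
      rw [← norm_eq_zero]; exact le_antisymm (by linarith [norm_nonneg (u y), hy.le]) (norm_nonneg _)
    have hF : Continuous fun t => ∫ s in y..t, a s := intervalIntegral.continuous_primitive ha y
    obtain ⟨δ, hδ, hδF⟩ := Metric.continuousAt_iff.1 (hF.continuousAt (x := y)) (1 / 8) (by norm_num)
    refine ⟨δ / 2, by positivity, ?_⟩
    obtain ⟨t, ht, hmax⟩ := (isCompact_closedBall y (δ / 2)).exists_isMaxOn
      ⟨y, Metric.mem_closedBall_self (by positivity)⟩ hcont.continuousOn
    set m := ‖u t‖ + ‖v t‖ with hm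
    have hm0 : 0 ≤ m := by positivity
    have hint : |∫ s in y..t, a s| < 1 / 8 := by
      have := @hδF t (lt_of_le_of_lt ht (by linarith))
      simpa [Real.dist_eq] using this
    have hint' : |∫ s in y..t, a s * m| ≤ m / 8 := by
      rw [intervalIntegral.integral_mul_const, abs_mul, abs_of_nonneg hm0]
      nlinarith
    have hsub : uIoc y t ⊆ Metric.closedBall y (δ / 2) := by
      refine uIoc_subset_uIcc.trans ?_
      rw [← segment_eq_uIcc]
      exact (convex_closedBall y _).segment_subset
        (Metric.mem_closedBall_self (by positivity)) ht
    have hbound : ∀ f : ℝ → ℂ, IsLocAC f → f y = 0 →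
        (∀ᵐ x : ℝ, ‖deriv f x‖ ≤ a x * (‖u x‖ + ‖v x‖)) → ‖f t‖ ≤ m / 4 := by
      intro f hf hfy hdf
      have := hf.norm_sub_le (a := y) (b := t) ((ha y t).mul_const m) (by
        filter_upwards [hdf] with s hs hsm
        exact hs.trans (mul_le_mul_of_nonneg_left (hmax (hsub hsm)) (ha0 s)))
      rw [hfy, sub_zero] at this
      linarith
    have h1 := hbound u hu hyu hdu
    have h2 := hbound v hv hyv hdv
    have hmz : m ≤ 0 := by linarith
    intro z hz
    exact le_antisymm ((hmax (Metric.ball_subset_closedBall hz)).trans hmz) (by positivity)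
  have huniv : S = univ := IsClopen.eq_univ ⟨hclosed, hopen⟩ ⟨x₀, by simp [hS, hu0, hv0]⟩
  have hx : ‖u x‖ + ‖v x‖ = 0 := by
    have : x ∈ S := huniv ▸ mem_univ x
    exact this
  constructor
  · rw [← norm_eq_zero]; exact le_antisymm (by linarith [norm_nonneg (v x)]) (norm_nonneg _)
  · rw [← norm_eq_zero]; exact le_antisymm (by linarith [norm_nonneg (u x)]) (norm_nonneg _)

/-! ### The space of square integrable solutions. -/

/-- The solutions `(u, v)` with `u ∈ L₂(ℝ)` of the first-order system
`u' = Q u + v`, `v' = -Q v + (c - Q²) u`. -/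
def squareIntegrableSolutions (Q : ℝ → ℂ) (c : ℂ) : Submodule ℂ ((ℝ → ℂ) × (ℝ → ℂ)) where
  carrier := {p | IsLocAC p.1 ∧ IsLocAC p.2 ∧ MemLp p.1 2 volume ∧
    (∀ᵐ x : ℝ, deriv p.1 x = Q x * p.1 x + p.2 x) ∧
    ∀ᵐ x : ℝ, deriv p.2 x = -(Q x * p.2 x) + (c - Q x ^ 2) * p.1 x}
  zero_mem' := by
    have h0 : IsLocAC 0 := fun a b =>
      (contDiff_const (c := (0 : ℂ))).contDiffOn.absolutelyContinuousOnInterval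
    exact ⟨h0, h0, MemLp.zero, by simp, by simp⟩
  add_mem' := by
    rintro p r ⟨hu, hv, hL, h1, h2⟩ ⟨hy, hz, hL', h3, h4⟩
    refine ⟨fun a b => (hu a b).add (hy a b), fun a b => (hv a b).add (hz a b), hL.add hL', ?_, ?_⟩
    · filter_upwards [h1, h3, hu.ae_differentiableAt, hy.ae_differentiableAt] with x e1 e2 d1 d2
      simp only [Prod.fst_add, Prod.snd_add, Pi.add_apply, deriv_add d1 d2, e1, e2]
      ring
    · filter_upwards [h2, h4, hv.ae_differentiableAt, hz.ae_differentiableAt] with x e1 e2 d1 d2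
      simp only [Prod.fst_add, Prod.snd_add, Pi.add_apply, deriv_add d1 d2, e1, e2]
      ring
  smul_mem' := by
    rintro k p ⟨hu, hv, hL, h1, h2⟩
    refine ⟨fun a b => (hu a b).const_smul k, fun a b => (hv a b).const_smul k,
      hL.const_smul k, ?_, ?_⟩
    · filter_upwards [h1, hu.ae_differentiableAt] with x e1 d1
      simp only [Prod.smul_fst, Prod.smul_snd, Pi.smul_apply, smul_eq_mul,
        deriv_const_smul k d1, e1]
      ring
    · filter_upwards [h2, hv.ae_differentiableAt] with x e1 d1
      simp only [Prod.smul_fst, Prod.smul_snd, Pi.smul_apply, smul_eq_mul,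
        deriv_const_smul k d1, e1]
      ring

/-- A solution is determined by its value at the origin. -/
lemma eq_zero_of_mem_squareIntegrableSolutions {Q : ℝ → ℂ} {c : ℂ}
    (hQ : ∀ s t, IntervalIntegrable (fun x => ‖Q x‖ ^ 2) volume s t)
    {p : (ℝ → ℂ) × (ℝ → ℂ)} (hp : p ∈ squareIntegrableSolutions Q c)
    (h0 : p.1 0 = 0) (h0' : p.2 0 = 0) : p = 0 := by
  obtain ⟨hu, hv, -, h1, h2⟩ := hp
  -- Since `‖Q‖ ≤ 1 + ‖Q‖ ^ 2`, this majorant dominates every coefficient `1`, `Q`, `c - Q ^ 2`, and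
  -- it only needs `‖Q‖ ^ 2` to be locally integrable.
  have key := eq_zero_of_norm_deriv_le hu hv (a := fun x => (2 + ‖c‖) + 2 * ‖Q x‖ ^ 2)
    (fun s t => intervalIntegrable_const.add ((hQ s t).const_mul 2)) (fun x => by positivity)
    ?_ ?_ h0 h0'
  · ext x
    · exact (key x).1
    · exact (key x).2
  · filter_upwards [h1] with x hx
    rw [hx]
    refine (norm_add_le _ _).trans ?_
    rw [norm_mul]
    have hq : ‖Q x‖ ≤ 1 + ‖Q x‖ ^ 2 := by nlinarith [sq_nonneg (‖Q x‖ - 1), norm_nonneg (Q x)]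
    have := mul_le_mul_of_nonneg_right hq (norm_nonneg (p.1 x))
    have c1 : 0 ≤ ‖c‖ * ‖p.1 x‖ := by positivity
    have c2 : 0 ≤ ‖c‖ * ‖p.2 x‖ := by positivity
    have c3 : 0 ≤ ‖Q x‖ ^ 2 * ‖p.2 x‖ := by positivity
    have c4 : 0 ≤ ‖Q x‖ ^ 2 * ‖p.1 x‖ := by positivity
    nlinarith [norm_nonneg (p.1 x), norm_nonneg (p.2 x)]
  · filter_upwards [h2] with x hx
    rw [hx]
    refine (norm_add_le _ _).trans ?_
    rw [norm_neg, norm_mul, norm_mul]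
    have hq : ‖Q x‖ ≤ 1 + ‖Q x‖ ^ 2 := by nlinarith [sq_nonneg (‖Q x‖ - 1), norm_nonneg (Q x)]
    have hq2 : ‖c - Q x ^ 2‖ ≤ ‖c‖ + ‖Q x‖ ^ 2 := by
      rw [← norm_pow]
      exact norm_sub_le c (Q x ^ 2)
    have t1 := mul_le_mul_of_nonneg_right hq (norm_nonneg (p.2 x))
    have t2 := mul_le_mul_of_nonneg_right hq2 (norm_nonneg (p.1 x))
    have c2 : 0 ≤ ‖c‖ * ‖p.2 x‖ := by positivity
    have c3 : 0 ≤ ‖Q x‖ ^ 2 * ‖p.2 x‖ := by positivity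
    have c4 : 0 ≤ ‖Q x‖ ^ 2 * ‖p.1 x‖ := by positivity
    nlinarith [norm_nonneg (p.1 x), norm_nonneg (p.2 x)]

/-- Evaluation at the origin embeds the space into `ℂ × ℂ`. -/
lemma finiteDimensional_squareIntegrableSolutions {Q : ℝ → ℂ} (c : ℂ)
    (hQ : ∀ s t, IntervalIntegrable (fun x => ‖Q x‖ ^ 2) volume s t) :
    FiniteDimensional ℂ (squareIntegrableSolutions Q c) := by
  let ev : ((ℝ → ℂ) × (ℝ → ℂ)) →ₗ[ℂ] ℂ × ℂ :=
    (LinearMap.proj (R := ℂ) (φ := fun _ : ℝ => ℂ) 0).prodMap (LinearMap.proj 0)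
  refine FiniteDimensional.of_injective (ev.domRestrict (squareIntegrableSolutions Q c)) ?_
  rw [injective_iff_map_eq_zero]
  rintro ⟨p, hp⟩ h
  have h' : ev p = 0 := h
  have := eq_zero_of_mem_squareIntegrableSolutions hQ hp (congrArg Prod.fst h')
    (congrArg Prod.snd h')
  exact Subtype.ext this

/-! ### The period shift and the Floquet argument. -/

/-- Translation by one period, acting on pairs of functions. -/
def periodShift : Module.End ℂ ((ℝ → ℂ) × (ℝ → ℂ)) :=
  (LinearMap.funLeft ℂ ℂ fun x : ℝ => x + 1).prodMap (LinearMap.funLeft ℂ ℂ fun x : ℝ => x + 1)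

lemma periodShift_mem {Q : ℝ → ℂ} (hper : Function.Periodic Q 1) {c : ℂ}
    {p : (ℝ → ℂ) × (ℝ → ℂ)} (hp : p ∈ squareIntegrableSolutions Q c) :
    periodShift p ∈ squareIntegrableSolutions Q c := by
  obtain ⟨hu, hv, hL, h1, h2⟩ := hp
  have hmp := measurePreserving_add_right (volume : Measure ℝ) 1
  refine ⟨hu.comp_add_const 1, hv.comp_add_const 1, hL.comp_measurePreserving hmp, ?_, ?_⟩
  · filter_upwards [hmp.quasiMeasurePreserving.ae h1] with x hx
    rw [hper x] at hx
    exact (deriv_comp_add_const _ _ _).trans hx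
  · filter_upwards [hmp.quasiMeasurePreserving.ae h2] with x hx
    rw [hper x] at hx
    exact (deriv_comp_add_const _ _ _).trans hx

/-- A Floquet-periodic continuous function in `L₂(ℝ)` vanishes. -/
lemma eq_zero_of_memLp_of_floquet {u : ℝ → ℂ} (hu : Continuous u) (hL : MemLp u 2 volume)
    {ρ : ℂ} (hρ : ∀ x, u (x + 1) = ρ * u x) : u = 0 := by
  have hI : Integrable (fun x => ‖u x‖ ^ 2) volume := hL.integrable_norm_pow two_ne_zero
  suffices h : ∫ x, ‖u x‖ ^ 2 = 0 by
    rw [integral_eq_zero_iff_of_nonneg (fun _ => by positivity) hI] at h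
    refine (Continuous.ae_eq_iff_eq volume hu continuous_zero).1 ?_
    filter_upwards [h] with x hx
    simpa using hx
  by_contra hne
  -- Translation invariance of the integral, assumed nonzero, forces `‖ρ‖ = 1`.
  have hsh : ∫ x, ‖u x‖ ^ 2 = ‖ρ‖ ^ 2 * ∫ x, ‖u x‖ ^ 2 := by
    rw [← integral_const_mul, ← integral_add_right_eq_self _ (1 : ℝ)]
    simp only [hρ, norm_mul, mul_pow]
  have hρ1 : ‖ρ‖ ^ 2 = 1 := by
    have : (‖ρ‖ ^ 2 - 1) * ∫ x, ‖u x‖ ^ 2 = 0 := by linarith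
    rcases mul_eq_zero.1 this with h | h
    · linarith
    · exact absurd h hne
  have hper : Function.Periodic (fun x => ‖u x‖ ^ 2) 1 := fun x => by
    simp only [hρ, norm_mul, mul_pow, hρ1, one_mul]
  -- The whole integral is now a sum over `ℤ` of equal integrals over unit cells; a summable
  -- constant family must be zero.
  have hsum := hI.hasSum_intervalIntegral_comp_add_int
  have hconst : ∀ n : ℤ, ∫ x in (0 : ℝ)..1, ‖u (x + n)‖ ^ 2 = ∫ x in (0 : ℝ)..1, ‖u x‖ ^ 2 := by
    intro n
    refine intervalIntegral.integral_congr fun x _ => ?_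
    simpa using hper.int_mul n x
  simp only [hconst] at hsum
  have hzero := tendsto_nhds_unique hsum.summable.tendsto_cofinite_zero tendsto_const_nhds
  rw [← hzero] at hsum
  exact hne (hsum.unique hasSum_zero)

/-- The system has no nontrivial solution with square integrable first component when `Q` is
periodic and locally square integrable. -/
theorem squareIntegrableSolutions_eq_bot {Q : ℝ → ℂ} (hper : Function.Periodic Q 1) (c : ℂ)
    (hQ : ∀ s t, IntervalIntegrable (fun x => ‖Q x‖ ^ 2) volume s t) :
    squareIntegrableSolutions Q c = ⊥ := by
  by_contra hne
  have := finiteDimensional_squareIntegrableSolutions c hQ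
  have : Nontrivial (squareIntegrableSolutions Q c) := Submodule.nontrivial_iff_ne_bot.2 hne
  obtain ⟨ρ, hρ⟩ := Module.End.exists_eigenvalue
    (periodShift.restrict fun p (hp : p ∈ squareIntegrableSolutions Q c) => periodShift_mem hper hp)
  obtain ⟨⟨p, hp⟩, hev⟩ := hρ.exists_hasEigenvector
  have hsh : periodShift p = ρ • p := congrArg Subtype.val hev.apply_eq_smul
  have hu0 : p.1 = 0 := eq_zero_of_memLp_of_floquet hp.1.continuous hp.2.2.1
    (fun x => congrFun (congrArg Prod.fst hsh) x)
  -- The first equation gives `v = u' - Q u = 0` almost everywhere, and `v` is continuous.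
  have hv0 : p.2 = 0 := by
    refine (Continuous.ae_eq_iff_eq volume hp.2.1.continuous continuous_zero).1 ?_
    filter_upwards [hp.2.2.2.1] with x hx
    simpa [hu0] using hx.symm
  exact hev.2 (Subtype.ext (Prod.ext hu0 hv0))

/-! ### Application to the antiderivative of the potential. -/

lemma antideriv_periodic (q : RealPerSobolev (-1)) : Function.Periodic (antideriv q) 1 := by
  intro x
  simp [antideriv]

lemma intervalIntegrable_norm_sq_antideriv (q : RealPerSobolev (-1)) (s t : ℝ) :
    IntervalIntegrable (fun x => ‖antideriv q x‖ ^ 2) volume s t := by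
  have hper : Function.Periodic (fun x => ‖antideriv q x‖ ^ 2) 1 := fun x => by
    simp only [antideriv_periodic q x]
  -- One period suffices; there the bound is pulled back from the circle, after passing from Haar to
  -- Lebesgue measure.
  refine hper.intervalIntegrable₀ one_ne_zero ?_ s t
  rw [intervalIntegrable_iff_integrableOn_Ioc_of_le zero_le_one]
  have hL : MemLp (antiderivL2 q) 2 (volume : Measure (AddCircle (1 : ℝ))) :=
    memLp_haarAddCircle_iff.1 (Lp.memLp _)
  have hI : Integrable (fun y => ‖antiderivL2 q y‖ ^ 2) (volume : Measure (AddCircle (1 : ℝ))) :=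
    hL.integrable_norm_pow two_ne_zero
  have hmp := AddCircle.measurePreserving_mk (1 : ℝ) 0
  rw [zero_add] at hmp
  exact hmp.integrable_comp_of_integrable hI

end HillSchrodinger

theorem proposition2p4 (q : HillSchrodinger.RealPerSobolev (-1)) :
    HillSchrodinger.pointSpectrum (HillSchrodinger.Smax q) = ∅ := by
  refine Set.eq_empty_of_forall_notMem ?_
  rintro z ⟨f, hf0, hfz⟩
  have hmem : ((f : HillSchrodinger.L2), z • (f : HillSchrodinger.L2)) ∈
      (HillSchrodinger.Smax q).graph :=
    (LinearPMap.mem_graph_iff _).2 ⟨f, rfl, hfz⟩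
  obtain ⟨u, v, hu, hv, hfu, huv, hg⟩ := (HillSchrodinger.mem_Smax_graph _ _ _).1 hmem
  -- Solving `l_Q[u] + q̂(0) u = z u` for `v'` gives the system with `c = q̂(0) - z`.
  have hsol : (u, v) ∈ HillSchrodinger.squareIntegrableSolutions (HillSchrodinger.antideriv q)
      (q.coeff 0 - z) := by
    refine ⟨hu, hv, (memLp_congr_ae hfu).1 (Lp.memLp _), ?_, ?_⟩
    · filter_upwards [huv] with x hx
      rw [← hx, HillSchrodinger.quasiDeriv]
      ring
    · filter_upwards [hg, hfu, Lp.coeFn_smul z (f : HillSchrodinger.L2)] with x h1 h2 h3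
      rw [h3, Pi.smul_apply, smul_eq_mul, h2, HillSchrodinger.quasiExpr] at h1
      linear_combination h1
  rw [HillSchrodinger.squareIntegrableSolutions_eq_bot (HillSchrodinger.antideriv_periodic q) _
    (HillSchrodinger.intervalIntegrable_norm_sq_antideriv q), Submodule.mem_bot] at hsol
  have hu0 : u = 0 := congrArg Prod.fst hsol
  refine hf0 (Lp.ext (hfu.trans ?_))
  rw [hu0]
  exact (Lp.coeFn_zero _ _ _).symm
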